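/- Let $C\subseteq\mathbb R^d$ be a Borel set with its Borel $\sigma$-algebra, let $\mu_1,\dots,\mu_n$ be probability measures on $C$ (the preferences of the players $N=\{1,\dots,n\}$), let $\nu$ be a finite measure on $C$, and let $f_i\ge 0$ be a finite version of the density $d\mu_i/d\nu$. Let $\Gamma=\{S_1,\dots,S_m\}$ be a partition of $N$ into nonempty coalitions, with weights $w(S_j)>0$, and put $$\mu_{S}(B)=\sup\Big\{\sum_{i\in S}\mu_i(D_i): (D_i)_{i\in S}\text{ a measurable partition of }B\Big\},\quad \mu_j^w=\frac{\mu_{S_j}}{w(S_j)},\quad f_j^w=\frac{\max_{i\in S_j}f_i}{w(S_j)},$$ $$v(\Gamma,w)=\sup_{(B_1,\dots,B_m)}\ \min_{1\le j\le m}\mu_j^w(B_j),\qquad g(\alpha)=\int_C\max_{1\le j\le m}\alpha_jf_j^w\,d\nu ,$$ where $(B_1,\dots,B_m)$ ranges over the partitions of $C$ into $m$ (possibly empty) measurable sets. Let $\Delta_{m-1}$ be the unit simplex in $\mathbb R^m$ and $\Delta^*_{m-1}$ the set of minimum points of $g$ on $\Delta_{m-1}$. A vector $u\in\mathbb R^m$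 is a partition value vector (PVV) of $\alpha$ if $u_j=\mu^w_j(B_j)$ for all $j$, for some measurable partition $(B_1,\dots,B_m)$ of $C$ such that $\alpha_kf^w_k(x)\ge\alpha_hf^w_h(x)$ for all $k,h$ and all $x\in B_k$. A diminishing step size rule is a sequence $(s_t)_{t\ge0}$ of positive reals with $s_t\to0$ and $\sum_t s_t=+\infty$. Assume (CD) for all $i$ and all measurable $A$ with $\mu_i(A)>0$ there is a measurable $B\subseteq A$ with $\mu_i(A\cap B)>0$ and $\mu_i(A\cap B^c)>0$; (MAC) if $\mu_i(A)>0$ for some $i$ and some measurable $A$, then $\mu_j(A)>0$ for all $j\ne i$. Then for every diminishing step size rule $(s_t)$ there is a diminishing step size rule $(s'_t)$ with $s'_t\le s_t$ for all $t$ such that the following holds for every $\alpha^0\in\Delta_{m-1}$ and all sequences $(\alpha^t)$, $(u^t)$ for which $u^t$ is a PVV of $\alpha^t$ and $$\alpha^{t+1}_i=\alpha^t_i-s'_t\,(u^t_i-\bar u^t)\quad(1\le i\le m),\qquad \bar u^t=\frac1m\sum_{i=1}^m u^t_i ,$$ for all $t\ge 0$: one has $\alpha^t_i-s'_t(u^t_i-\bar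 u^t)>0$ for all $t$ and $i$ and $\alpha^t\in\Delta_{m-1}$ for all $t$; and either $\alpha^{t^*}\in\Delta^*_{m-1}$ for some $t^*$, or there is $\alpha^*\in\Delta^*_{m-1}$ with $$\lim_{t\to\infty}\alpha^t=\alpha^*,\qquad \lim_{t\to\infty}g(\alpha^t)=g(\alpha^*)=v(\Gamma,w).$$ -/

import Mathlib

open Filter Topology MeasureTheory

namespace FairDivision

noncomputable section

/-- A partition of the set `A` into measurable pieces indexed by `κ`; pieces may be empty. -/
structure IsMeasPartition {X : Type*} [MeasurableSpace X] {κ : Type*}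
    (A : Set X) (B : κ → Set X) : Prop where
  measurableSet : ∀ k, MeasurableSet (B k)
  disjoint : Pairwise fun k l => Disjoint (B k) (B l)
  iUnion_eq : ⋃ k, B k = A

/-- Complete divisibility of the good (CD). -/
def CompletelyDivisible {X : Type*} [MeasurableSpace X] {ι : Type*} (μ : ι → Measure X) : Prop :=
  ∀ i, ∀ A : Set X, MeasurableSet A → 0 < μ i A →
    ∃ B : Set X, MeasurableSet B ∧ B ⊆ A ∧ 0 < μ i (A ∩ B) ∧ 0 < μ i (A ∩ Bᶜ)

/-- Mutual absolute continuity of the preferences (MAC). -/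
def MutuallyAbsCont {X : Type*} [MeasurableSpace X] {ι : Type*} (μ : ι → Measure X) : Prop :=
  ∀ i, ∀ A : Set X, MeasurableSet A → 0 < μ i A → ∀ j, j ≠ i → 0 < μ j A

/-- `f` is a (finite, everywhere defined) version of the Radon-Nikodym derivative `dμ/dν`. -/
structure IsRNDensity {X : Type*} [MeasurableSpace X] (μ ν : Measure X) (f : X → ℝ) : Prop where
  measurable : Measurable f
  nonneg : ∀ x, 0 ≤ f x
  apply_eq : ∀ A : Set X, MeasurableSet A → μ A = ∫⁻ x in A, ENNReal.ofReal (f x) ∂ν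

/-- Joint preference `μ_S` of a coalition `S`: the maximal total value that the members of `S`
can obtain by dividing `B` among themselves. -/
def coalitionValue {X : Type*} [MeasurableSpace X] {ι : Type*} (μ : ι → Measure X)
    (S : Finset ι) (B : Set X) : ℝ :=
  sSup {r : ℝ | ∃ D : S → Set X, IsMeasPartition B D ∧
    r = ∑ i : S, (μ i).real (D i)}

/-- Density `f_S = max_{i ∈ S} f_i` of a coalition `S`. -/
def coalitionDensity {X : Type*} {ι : Type*} (f : ι → X → ℝ) (S : Finset ι) (x : X) : ℝ :=
  ⨆ i : S, f i x

section Game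

variable {X : Type*} [MeasurableSpace X] {ι : Type*} [Fintype ι] [DecidableEq ι]

/-- Weighted preference `μ_j^w = μ_{S_j} / w(S_j)` of a coalition of the structure `Γ`. -/
def weightedValue (μ : ι → Measure X) (w : Finset ι → ℝ)
    (Γ : Finpartition (Finset.univ : Finset ι)) (j : Γ.parts) (B : Set X) : ℝ :=
  coalitionValue μ j B / w j

/-- Weighted density `f_j^w = f_{S_j} / w(S_j)` of a coalition of the structure `Γ`. -/
def weightedDensity (f : ι → X → ℝ) (w : Finset ι → ℝ)
    (Γ : Finpartition (Finset.univ : Finset ι)) (j : Γ.parts) (x : X) : ℝ :=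
  coalitionDensity f j x / w j

/-- The maxmin value `v(Γ, w)`. -/
def maxminValue (μ : ι → Measure X) (w : Finset ι → ℝ)
    (Γ : Finpartition (Finset.univ : Finset ι)) : ℝ :=
  sSup {r : ℝ | ∃ B : Γ.parts → Set X, IsMeasPartition Set.univ B ∧
    r = ⨅ j, weightedValue μ w Γ j (B j)}

/-- `g(α) = ∫_C max_j α_j f_j^w`. -/
def g (ν : Measure X) (f : ι → X → ℝ) (w : Finset ι → ℝ)
    (Γ : Finpartition (Finset.univ : Finset ι)) (α : Γ.parts → ℝ) : ℝ :=
  ∫ x, (⨆ j, α j * weightedDensity f w Γ j x) ∂ν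

/-- The set of minimum points of `g` on the unit simplex. -/
def minimizers (ν : Measure X) (f : ι → X → ℝ) (w : Finset ι → ℝ)
    (Γ : Finpartition (Finset.univ : Finset ι)) : Set (Γ.parts → ℝ) :=
  {α | α ∈ stdSimplex ℝ Γ.parts ∧ ∀ β ∈ stdSimplex ℝ Γ.parts, g ν f w Γ α ≤ g ν f w Γ β}

/-- `u` is a partition value vector (PVV) for `α`: it collects the weighted values of a partition
that gives each point to a coalition with maximal `α_k f_k^w`. -/
def IsPVV (μ : ι → Measure X) (f : ι → X → ℝ) (w : Finset ι → ℝ)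
    (Γ : Finpartition (Finset.univ : Finset ι)) (α u : Γ.parts → ℝ) : Prop :=
  ∃ B : Γ.parts → Set X, IsMeasPartition Set.univ B ∧
    (∀ k h, ∀ x ∈ B k, α h * weightedDensity f w Γ h x ≤ α k * weightedDensity f w Γ k x) ∧
    ∀ j, u j = weightedValue μ w Γ j (B j)

end Game

/-- Diminishing step size rule. -/
structure IsDiminishing (s : ℕ → ℝ) : Prop where
  pos : ∀ t, 0 < s t
  tendsto_zero : Tendsto s atTop (𝓝 0)
  sum_eq_top : Tendsto (fun T => ∑ t ∈ Finset.range T, s t) atTop atTop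

/-- Average of the components of a vector. -/
def avg {κ : Type*} [Fintype κ] (u : κ → ℝ) : ℝ := (∑ j, u j) / Fintype.card κ

end

end FairDivision

/-! The integral of a pointwise maximum is reached by giving each point to a coalition that
maximises `α_j f_j^w`, so `g(α)` is the largest `α`-weighted total over all divisions: the support
function of the set of value vectors. A PVV of `α` is thus a subgradient of `g` at `α`. Subtracting
its mean makes the step tangent to the simplex, and the iteration is a subgradient method.

No projection is needed. By (MAC) the densities vanish together almost everywhere, so a coalition
with tiny weight receives almost nothing, less than the average, and its weight grows
(`exists_forall_divisionValue_lt_avg`); other weights stay positive if the steps are small.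
Shrinking the steps further, to be square summable with divergent sum, makes the iterates
quasi-Fejér monotone, hence convergent to a single minimizer (`exists_tendsto_of_subgradient_step`).

That the minimum of `g` is `v(Γ, w)` is a minimax statement. (CD) excludes atoms where a density is
positive, so the closure of the set of value vectors is convex (approximate Lyapunov), and
Hahn-Banach separation from an open orthant applies (`exists_division_forall_lt`). -/

namespace FairDivision

/-! ### Atomless measures and approximate Lyapunov convexity -/

/-- **Sierpiński's theorem** for finite atomless measures on a standard Borel space. -/
theorem exists_subset_measureReal_eq_mul {X : Type*} [MeasurableSpace X] [StandardBorelSpace X]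
    (ν : Measure X) [IsFiniteMeasure ν] [NullSingletonClass ν] {A : Set X} (hA : MeasurableSet A)
    {c : ℝ} (hc₀ : 0 ≤ c) (hc₁ : c ≤ 1) :
    ∃ E ⊆ A, MeasurableSet E ∧ ν.real E = c * ν.real A := by
  rcases hc₀.eq_or_lt with rfl | hc₀
  · exact ⟨∅, Set.empty_subset _, MeasurableSet.empty, by simp⟩
  rcases hc₁.eq_or_lt with rfl | hc₁
  · exact ⟨A, subset_rfl, hA, by simp⟩
  rcases (measureReal_nonneg (μ := ν) (s := A)).eq_or_lt with hA0 | hA0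
  · exact ⟨∅, Set.empty_subset _, MeasurableSet.empty, by simp [← hA0]⟩
  -- On the real line, the image of `ν` restricted to `A` has a continuous distribution function,
  -- and the intermediate value theorem finds the level `c * ν.real A`.
  have he := measurableEmbedding_embeddingReal X
  set e := embeddingReal X
  set m : Measure ℝ := (ν.restrict A).map e with hm
  have hfin : IsFiniteMeasure m := by rw [hm]; infer_instance
  have hm_apply : ∀ S : Set ℝ, MeasurableSet S → m.real S = ν.real (e ⁻¹' S ∩ A) := by
    intro S hS
    rw [measureReal_def, hm, Measure.map_apply he.measurable hS,
      Measure.restrict_apply (he.measurable hS), measureReal_def]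
  have hna : NullSingletonClass m := by
    refine ⟨fun x => ?_⟩
    rw [hm, Measure.map_apply he.measurable (measurableSet_singleton x)]
    have : (e ⁻¹' {x}).Subsingleton := fun a ha b hb => he.injective (by simp_all)
    exact this.measure_zero _
  have htot : m.real Set.univ = ν.real A := by simp [hm_apply]
  have hcont : Continuous fun t => m.real (Set.Iic t) := by
    have h1 : Continuous fun b => ∫ x in (0:ℝ)..b, (1:ℝ) ∂m :=
      intervalIntegral.continuous_primitive (fun a b => by simp) 0
    have h2 : (fun t => m.real (Set.Iic t)) =
        fun t => m.real (Set.Iic 0) + ∫ x in (0:ℝ)..t, (1:ℝ) ∂m := by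
      funext t
      rw [← intervalIntegral.integral_Iic_sub_Iic (by simp) (by simp)]
      simp
    rw [h2]
    exact continuous_const.add h1
  have htop : Tendsto (fun t => m.real (Set.Iic t)) atTop (𝓝 (ν.real A)) := by
    rw [← htot]
    exact (ENNReal.tendsto_toReal (measure_ne_top m _)).comp (tendsto_measure_Iic_atTop m)
  have hbot : Tendsto (fun t => m.real (Set.Ici t)) atBot (𝓝 (ν.real A)) := by
    rw [← htot]
    exact (ENNReal.tendsto_toReal (measure_ne_top m _)).comp (tendsto_measure_Ici_atBot m)
  obtain ⟨b, hb⟩ := (htop.eventually (lt_mem_nhds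
    (show c * ν.real A < ν.real A by nlinarith))).exists
  obtain ⟨a, ha⟩ := (hbot.eventually (lt_mem_nhds
    (show (1 - c) * ν.real A < ν.real A by nlinarith))).exists
  have ha' : m.real (Set.Iic a) ≤ c * ν.real A := by
    have h1 : m.real (Set.Iic a) = m.real (Set.Iio a) :=
      (measureReal_congr Iio_ae_eq_Iic).symm
    have h2 := measureReal_compl (μ := m) (measurableSet_Ici (a := a))
    rw [Set.compl_Ici, htot] at h2
    rw [h1, h2]
    nlinarith
  obtain ⟨t, ht⟩ := mem_range_of_exists_le_of_exists_ge hcont ⟨a, ha'⟩ ⟨b, hb.le⟩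
  refine ⟨e ⁻¹' Set.Iic t ∩ A, Set.inter_subset_right, (he.measurable measurableSet_Iic).inter hA, ?_⟩
  rw [← hm_apply _ measurableSet_Iic, ← ht]

/-- Approximate **Lyapunov convexity theorem** for indefinite integrals with respect to a finite
atomless measure. -/
theorem exists_norm_setIntegral_sub_smul_integral_lt {X F : Type*} [MeasurableSpace X]
    [StandardBorelSpace X] [NormedAddCommGroup F] [NormedSpace ℝ F] [CompleteSpace F]
    (ν : Measure X) [IsFiniteMeasure ν] [NullSingletonClass ν] {φ : X → F} (hφ : Integrable φ ν)
    {c : ℝ} (hc₀ : 0 ≤ c) (hc₁ : c ≤ 1) {ε : ℝ} (hε : 0 < ε) :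
    ∃ E, MeasurableSet E ∧ ‖∫ x in E, φ x ∂ν - c • ∫ x, φ x ∂ν‖ < ε := by
  obtain ⟨S, hS, hSmem⟩ := (memLp_one_iff_integrable.2 hφ).exists_simpleFunc_eLpNorm_sub_lt
    (by simp) (ε := ENNReal.ofReal (ε / 2)) (by simpa using hε)
  have hSint : Integrable S ν := memLp_one_iff_integrable.1 hSmem
  have hdiff : ∫ x, ‖φ x - S x‖ ∂ν < ε / 2 := by
    have h := integral_norm_eq_lintegral_enorm (hφ.sub hSint).aestronglyMeasurable
    simp only [Pi.sub_apply] at h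
    rw [h]
    simp only [eLpNorm_one_eq_lintegral_enorm, Pi.sub_apply] at hS
    exact ENNReal.toReal_lt_of_lt_ofReal hS
  -- Cutting every fibre of the simple function in proportion `c` makes the claim exact for it; the
  -- two `L¹` errors are each below `ε / 2`.
  choose E hEsub hEmeas hE using fun y : S.range =>
    exists_subset_measureReal_eq_mul ν (S.measurableSet_fiber (y : F)) hc₀ hc₁
  have hEm : MeasurableSet (⋃ y, E y) := MeasurableSet.iUnion hEmeas
  have hfib : ∀ y : S.range, S ⁻¹' {(y : F)} ∩ (⋃ z, E z) = E y := by
    intro y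
    ext x
    simp only [Set.mem_inter_iff, Set.mem_preimage, Set.mem_singleton_iff, Set.mem_iUnion]
    constructor
    · rintro ⟨hx, z, hz⟩
      have : S x = z := hEsub z hz
      have hzy : z = y := Subtype.ext (this.symm.trans hx)
      exact hzy ▸ hz
    · exact fun hx => ⟨hEsub y hx, y, hx⟩
  have hSE : ∫ x in ⋃ y, E y, S x ∂ν = c • ∫ x, S x ∂ν := by
    rw [S.integral_eq_sum hSint.restrict, S.integral_eq_sum hSint, Finset.smul_sum]
    refine Finset.sum_congr rfl fun y hy => ?_
    rw [measureReal_restrict_apply (S.measurableSet_fiber y), hfib ⟨y, hy⟩, hE, mul_smul]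
  refine ⟨_, hEm, ?_⟩
  have e1 : ∫ x in ⋃ y, E y, φ x ∂ν - c • ∫ x, φ x ∂ν =
      ∫ x in ⋃ y, E y, (φ x - S x) ∂ν - c • ∫ x, (φ x - S x) ∂ν := by
    rw [integral_sub hφ hSint, integral_sub hφ.integrableOn hSint.integrableOn, hSE, smul_sub]
    abel
  have e2 : ‖∫ x in ⋃ y, E y, (φ x - S x) ∂ν‖ < ε / 2 :=
    ((norm_integral_le_integral_norm _).trans (setIntegral_le_integral (hφ.sub hSint).norm
      (ae_of_all _ fun x => norm_nonneg _))).trans_lt hdiff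
  have e3 : ‖c • ∫ x, (φ x - S x) ∂ν‖ < ε / 2 := by
    rw [norm_smul, Real.norm_of_nonneg hc₀]
    have := (norm_integral_le_integral_norm (μ := ν) (fun x => φ x - S x)).trans_lt hdiff
    nlinarith [norm_nonneg (∫ x, (φ x - S x) ∂ν)]
  rw [e1]
  linarith [norm_sub_le (∫ x in ⋃ y, E y, (φ x - S x) ∂ν) (c • ∫ x, (φ x - S x) ∂ν)]

/-! ### Step sizes and convergence of the subgradient method -/

/-- Every diminishing step size rule dominates one that is square summable and bounded by a
prescribed positive constant. -/
theorem IsDiminishing.exists_le_summable_sq {s : ℕ → ℝ} (hs : IsDiminishing s) {c : ℝ}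
    (hc : 0 < c) :
    ∃ s' : ℕ → ℝ, IsDiminishing s' ∧ (∀ t, s' t ≤ s t) ∧ (∀ t, s' t ≤ c) ∧
      Summable fun t => s' t ^ 2 := by
  -- Since `s` tends to zero, the cap is eventually inactive and the sum still diverges.
  set a : ℕ → ℝ := fun t => min (s t) (min 1 c) with ha
  have ha0 : ∀ t, 0 < a t := fun t => lt_min (hs.pos t) (lt_min one_pos hc)
  have ha1 : ∀ t, a t ≤ 1 := fun t => (min_le_right _ _).trans (min_le_left _ _)
  have hac : ∀ t, a t ≤ c := fun t => (min_le_right _ _).trans (min_le_right _ _)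
  have has : ∀ t, a t ≤ s t := fun t => min_le_left _ _
  have hasum : Tendsto (fun T => ∑ t ∈ Finset.range T, a t) atTop atTop := by
    rw [← not_summable_iff_tendsto_nat_atTop_of_nonneg fun t => (ha0 t).le]
    have hns := (not_summable_iff_tendsto_nat_atTop_of_nonneg fun t => (hs.pos t).le).2
      hs.sum_eq_top
    refine fun h => hns (summable_of_isBigO_nat h (Asymptotics.IsBigO.of_bound 1 ?_))
    filter_upwards [hs.tendsto_zero.eventually (gt_mem_nhds (lt_min one_pos hc))] with t ht
    simp only [ha]
    rw [one_mul, min_eq_left ht.le]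
  -- Abel-Dini: `∑ a / A` dominates `log A`, which diverges, while `(a / A) ^ 2` is at most a
  -- telescoping difference of `2 / A`, because `a ≤ 1 ≤ A`.
  set A : ℕ → ℝ := fun t => 1 + ∑ k ∈ Finset.range t, a k with hA
  have hA1 : ∀ t, 1 ≤ A t := fun t =>
    le_add_of_nonneg_right (Finset.sum_nonneg fun k _ => (ha0 k).le)
  have hAsucc : ∀ t, A (t + 1) = A t + a t := fun t => by
    simp only [hA, Finset.sum_range_succ]; ring
  have hA0 : ∀ t, 0 < A t := fun t => one_pos.trans_le (hA1 t)
  have hpos : ∀ t, 0 < a t / A t := fun t => div_pos (ha0 t) (hA0 t)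
  have hle : ∀ t, a t / A t ≤ a t := fun t => div_le_self (ha0 t).le (hA1 t)
  refine ⟨fun t => a t / A t, ⟨hpos, ?_, ?_⟩, fun t => (hle t).trans (has t),
    fun t => (hle t).trans (hac t), ?_⟩
  · exact squeeze_zero (fun t => (hpos t).le) (fun t => (hle t).trans (has t)) hs.tendsto_zero
  · have hlog : ∀ n, Real.log (A n) ≤ ∑ t ∈ Finset.range n, a t / A t := by
      intro n
      induction n with
      | zero => simp [hA]
      | succ n ih =>
        rw [Finset.sum_range_succ]
        have h1 : A (n + 1) = A n * (1 + a n / A n) := by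
          rw [hAsucc]; field_simp [(hA0 n).ne']
        have h2 : 0 < 1 + a n / A n := by linarith [hpos n]
        rw [h1, Real.log_mul (hA0 n).ne' h2.ne']
        linarith [Real.log_le_sub_one_of_pos h2]
    refine tendsto_atTop_mono hlog (Real.tendsto_log_atTop.comp ?_)
    exact tendsto_atTop_add_const_left _ _ hasum
  · refine summable_of_sum_range_le (c := 2) (fun t => sq_nonneg _) fun n => ?_
    have key : ∑ t ∈ Finset.range n, (a t / A t) ^ 2 ≤ 2 * (1 - 1 / A n) := by
      induction n with
      | zero => simp [hA]
      | succ n ih =>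
        rw [Finset.sum_range_succ]
        have h1 : (a n / A n) ^ 2 ≤ 2 * (1 / A n - 1 / A (n + 1)) := by
          have hn := hA0 n
          have hn1 := hA0 (n + 1)
          have e : 2 * (1 / A n - 1 / A (n + 1)) = 2 * a n / (A n * A (n + 1)) := by
            field_simp
            rw [hAsucc]; ring
          rw [e, div_pow, div_le_div_iff₀ (by positivity) (by positivity), hAsucc]
          have := ha0 n
          have h3 := ha1 n
          have h4 := hA1 n
          nlinarith [mul_pos this hn, mul_nonneg (mul_pos this hn).le (sub_nonneg.2 h4),
            mul_nonneg (mul_pos this hn).le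
              (show 0 ≤ 2 * A n - a n * (A n + a n) by nlinarith)]
        linarith
    have : 0 < 1 / A n := one_div_pos.2 (hA0 n)
    linarith

/-- Convergence of the (quasi-Fejér monotone) subgradient method with square summable steps on a
compact set. -/
theorem exists_tendsto_of_subgradient_step {κ : Type*} [Fintype κ] {K : Set (κ → ℝ)}
    (hK : IsCompact K) {G : (κ → ℝ) → ℝ} (hG : Continuous G) {α p : ℕ → κ → ℝ} {s : ℕ → ℝ}
    (hs : IsDiminishing s) (hs2 : Summable fun t => s t ^ 2) (hα : ∀ t, α t ∈ K)
    (hstep : ∀ t j, α (t + 1) j = α t j - s t * p t j) {M : ℝ}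
    (hM : ∀ t, ∑ j, p t j ^ 2 ≤ M)
    (hsub : ∀ t, ∀ b ∈ K, ∑ j, p t j * (b j - α t j) ≤ G b - G (α t)) :
    ∃ a ∈ K, (∀ b ∈ K, G a ≤ G b) ∧ Tendsto α atTop (𝓝 a) := by
  have hM0 : 0 ≤ M := (Finset.sum_nonneg fun j _ => sq_nonneg _).trans (hM 0)
  have hdesc : ∀ b ∈ K, ∀ t, ∑ j, (α (t + 1) j - b j) ^ 2 ≤
      ∑ j, (α t j - b j) ^ 2 - 2 * (s t * (G (α t) - G b)) + M * s t ^ 2 := by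
    intro b hb t
    have e : ∑ j, (α (t + 1) j - b j) ^ 2 = ∑ j, (α t j - b j) ^ 2 +
        2 * s t * (∑ j, p t j * (b j - α t j)) + s t ^ 2 * ∑ j, p t j ^ 2 := by
      rw [Finset.mul_sum, Finset.mul_sum, ← Finset.sum_add_distrib, ← Finset.sum_add_distrib]
      refine Finset.sum_congr rfl fun j _ => ?_
      rw [hstep]; ring
    have h1 := mul_le_mul_of_nonneg_left (hsub t b hb) (mul_pos two_pos (hs.pos t)).le
    have h2 := mul_le_mul_of_nonneg_left (hM t) (sq_nonneg (s t))
    rw [e]; linarith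
  obtain ⟨b, hb, hbmin⟩ := hK.exists_isMinOn ⟨_, hα 0⟩ hG.continuousOn
  have hbmin' : ∀ x ∈ K, G b ≤ G x := fun x hx => hbmin hx
  have hsq : ∀ n, ∑ t ∈ Finset.range n, s t ^ 2 ≤ ∑' t, s t ^ 2 := fun n =>
    hs2.sum_le_tsum _ fun t _ => sq_nonneg _
  have hgap : Summable fun t => s t * (G (α t) - G b) := by
    refine summable_of_sum_range_le (c := ∑ j, (α 0 j - b j) ^ 2 + M * ∑' t, s t ^ 2)
      (fun t => mul_nonneg (hs.pos t).le (sub_nonneg.2 (hbmin' _ (hα t)))) fun n => ?_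
    have h1 : ∀ n, ∑ j, (α n j - b j) ^ 2 + 2 * ∑ t ∈ Finset.range n, s t * (G (α t) - G b) ≤
        ∑ j, (α 0 j - b j) ^ 2 + M * ∑ t ∈ Finset.range n, s t ^ 2 := by
      intro n
      induction n with
      | zero => simp
      | succ n ih =>
        rw [Finset.sum_range_succ, Finset.sum_range_succ]
        linarith [hdesc b hb n]
    have h2 : 0 ≤ ∑ t ∈ Finset.range n, s t * (G (α t) - G b) := Finset.sum_nonneg fun t _ =>
      mul_nonneg (hs.pos t).le (sub_nonneg.2 (hbmin' _ (hα t)))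
    have h3 : 0 ≤ ∑ j, (α n j - b j) ^ 2 := Finset.sum_nonneg fun j _ => sq_nonneg _
    linarith [h1 n, mul_le_mul_of_nonneg_left (hsq n) hM0]
  -- A gap bounded away from zero would make `s` summable, by `hgap`.
  have hfreq : ∀ n : ℕ, ∃ᶠ t in atTop, G (α t) < G b + 1 / (n + 1 : ℝ) := by
    intro n hn
    have hε : (0 : ℝ) < 1 / (n + 1 : ℝ) := by positivity
    refine (not_summable_iff_tendsto_nat_atTop_of_nonneg fun t => (hs.pos t).le).2 hs.sum_eq_top
      (summable_of_isBigO_nat hgap (Asymptotics.IsBigO.of_bound (n + 1 : ℝ) ?_))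
    filter_upwards [hn] with t ht
    rw [not_lt] at ht
    have h1 := hs.pos t
    have h2 : 1 / (n + 1 : ℝ) ≤ G (α t) - G b := by linarith
    rw [Real.norm_of_nonneg h1.le, Real.norm_of_nonneg (mul_nonneg h1.le (hε.le.trans h2))]
    have h3 : (n + 1 : ℝ) * (1 / (n + 1 : ℝ)) = 1 := by field_simp
    calc s t = (n + 1 : ℝ) * (s t * (1 / (n + 1 : ℝ))) := by rw [mul_left_comm, h3, mul_one]
      _ ≤ _ := by gcongr
  obtain ⟨φ, hφ, hφG⟩ := extraction_forall_of_frequently hfreq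
  obtain ⟨a, haK, ψ, hψ, hlim⟩ := hK.tendsto_subseq fun n => hα (φ n)
  have hGa : G a ≤ G b := by
    have h1 : Tendsto (fun n => G (α (φ (ψ n)))) atTop (𝓝 (G a)) := (hG.tendsto a).comp hlim
    have h2 : Tendsto (fun n => G b + 1 / ((ψ n : ℝ) + 1)) atTop (𝓝 (G b + 0)) :=
      tendsto_const_nhds.add (tendsto_one_div_add_atTop_nhds_zero_nat.comp hψ.tendsto_atTop)
    rw [add_zero] at h2
    exact le_of_tendsto_of_tendsto' h1 h2 fun n => (hφG _).le
  have hamin : ∀ x ∈ K, G a ≤ G x := fun x hx => hGa.trans (hbmin' x hx)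
  refine ⟨a, haK, hamin, ?_⟩
  -- With the cluster point `a` itself as reference, the squared distance corrected by the
  -- accumulated error decreases. So the distance converges, and the subsequence forces its limit to
  -- be zero.
  have hanti : Antitone fun t => ∑ j, (α t j - a j) ^ 2 - M * ∑ k ∈ Finset.range t, s k ^ 2 := by
    refine antitone_nat_of_succ_le fun t => ?_
    rw [Finset.sum_range_succ]
    have := mul_nonneg (hs.pos t).le (sub_nonneg.2 (hamin _ (hα t)))
    linarith [hdesc a haK t]
  have hbdd : BddBelow (Set.range fun t => ∑ j, (α t j - a j) ^ 2 -
      M * ∑ k ∈ Finset.range t, s k ^ 2) := by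
    refine ⟨-(M * ∑' k, s k ^ 2), ?_⟩
    rintro _ ⟨t, rfl⟩
    have h3 : 0 ≤ ∑ j, (α t j - a j) ^ 2 := Finset.sum_nonneg fun j _ => sq_nonneg _
    have := mul_le_mul_of_nonneg_left (hsq t) hM0
    dsimp only
    linarith
  have hconv := (tendsto_atTop_ciInf hanti hbdd).add (hs2.hasSum.tendsto_sum_nat.const_mul M)
  simp only [sub_add_cancel] at hconv
  have hzero : Tendsto (fun n => ∑ j, (α (φ (ψ n)) j - a j) ^ 2) atTop (𝓝 0) := by
    have : Tendsto (fun n => ∑ j, (α (φ (ψ n)) j - a j) ^ 2) atTop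
        (𝓝 (∑ j, (a j - a j) ^ 2)) :=
      tendsto_finsetSum _ fun j _ => (((tendsto_pi_nhds.1 hlim) j).sub_const _).pow 2
    simpa using this
  have hL := tendsto_nhds_unique
    (hconv.comp (hφ.tendsto_atTop.comp hψ.tendsto_atTop)) hzero
  rw [hL] at hconv
  rw [tendsto_pi_nhds]
  intro j
  rw [tendsto_iff_norm_sub_tendsto_zero]
  have hj : Tendsto (fun t => (α t j - a j) ^ 2) atTop (𝓝 0) :=
    squeeze_zero (fun t => sq_nonneg _) (fun t => Finset.single_le_sum
      (f := fun j => (α t j - a j) ^ 2) (fun i _ => sq_nonneg _) (Finset.mem_univ j)) hconv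
  have := hj.sqrt
  simpa [Real.sqrt_sq_eq_abs] using this

/-! ### Measurable partitions and pointwise maxima -/

theorem le_iSup_apply {X κ : Type*} [Finite κ] (h : κ → X → ℝ) (k : κ) (x : X) :
    h k x ≤ ⨆ l, h l x :=
  le_ciSup (f := fun l => h l x) (Set.finite_range _).bddAbove k

section Partition

variable {X κ : Type*} [MeasurableSpace X]

theorem IsMeasPartition.inter_right {A : Set X} {B : κ → Set X} (hB : IsMeasPartition A B)
    {S : Set X} (hS : MeasurableSet S) : IsMeasPartition (A ∩ S) fun k => B k ∩ S where
  measurableSet k := (hB.measurableSet k).inter hS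
  disjoint _ _ hkl := (hB.disjoint hkl).mono Set.inter_subset_left Set.inter_subset_left
  iUnion_eq := by rw [← Set.iUnion_inter, hB.iUnion_eq]

theorem IsMeasPartition.ite {A : Set X} {B B' : κ → Set X} (hB : IsMeasPartition A B)
    (hB' : IsMeasPartition A B') {E : Set X} (hE : MeasurableSet E) :
    IsMeasPartition A fun k => E.ite (B k) (B' k) where
  measurableSet k := hE.ite (hB.measurableSet k) (hB'.measurableSet k)
  disjoint k l hkl := by
    have h := Set.disjoint_left.1 (hB.disjoint hkl)
    have h' := Set.disjoint_left.1 (hB'.disjoint hkl)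
    refine Set.disjoint_left.2 fun x hx hy => ?_
    by_cases hxE : x ∈ E <;> simp_all [Set.ite]
  iUnion_eq := by
    ext x
    have h := Set.ext_iff.1 hB.iUnion_eq x
    have h' := Set.ext_iff.1 hB'.iUnion_eq x
    rw [Set.mem_iUnion] at h h' ⊢
    by_cases hxE : x ∈ E <;> simp_all [Set.ite]

variable [Fintype κ]

theorem IsMeasPartition.sum_setIntegral {ν : Measure X} {A : Set X} {B : κ → Set X}
    (hB : IsMeasPartition A B) {φ : X → ℝ} (hφ : Integrable φ ν) :
    ∑ k, ∫ x in B k, φ x ∂ν = ∫ x in A, φ x ∂ν := by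
  rw [← hB.iUnion_eq]
  exact (integral_iUnion_fintype hB.measurableSet hB.disjoint fun _ => hφ.integrableOn).symm

variable [Nonempty κ]

/-- Each point can be given, measurably, to an index at which `h` is maximal. -/
theorem exists_argmax_partition {h : κ → X → ℝ} (hh : ∀ k, Measurable (h k)) :
    ∃ B : κ → Set X, IsMeasPartition Set.univ B ∧ ∀ k l, ∀ x ∈ B k, h l x ≤ h k x := by
  classical
  let e := Fintype.equivFin κ
  let A : κ → Set X := fun k => ⋂ l, {x | h l x ≤ h k x}
  have hA : ∀ k, MeasurableSet (A k) := fun k =>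
    MeasurableSet.iInter fun l => measurableSet_le (hh l) (hh k)
  -- Ties go to the first maximal index in the enumeration `e`.
  refine ⟨fun k => A k \ ⋃ l, ⋃ (_ : e l < e k), A l, ⟨fun k => ?_, ?_, ?_⟩, ?_⟩
  · exact (hA k).diff (MeasurableSet.iUnion fun l => MeasurableSet.iUnion fun _ => hA l)
  · intro k l hkl
    refine Set.disjoint_left.2 fun x hx hy => ?_
    simp only [Set.mem_sdiff, Set.mem_iUnion, not_exists] at hx hy
    rcases lt_trichotomy (e k) (e l) with hlt | heq | hlt
    · exact hy.2 k hlt hx.1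
    · exact hkl (e.injective heq)
    · exact hx.2 l hlt hy.1
  · refine Set.eq_univ_of_forall fun x => ?_
    have hne : (Finset.univ.filter fun i => x ∈ A (e.symm i)).Nonempty := by
      obtain ⟨k, hk⟩ := Finite.exists_max fun k => h k x
      exact ⟨e k, by simpa [A] using hk⟩
    have hmem := Finset.min'_mem _ hne
    set i := Finset.min' _ hne
    refine Set.mem_iUnion.2 ⟨e.symm i, (Finset.mem_filter.1 hmem).2, ?_⟩
    simp only [Set.mem_iUnion, not_exists]
    intro l hl hx
    rw [e.apply_symm_apply] at hl
    exact hl.not_ge (Finset.min'_le _ _ (by simpa using hx))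
  · intro k l x hx
    exact Set.mem_iInter.1 hx.1 l

theorem integrable_iSup {ν : Measure X} {h : κ → X → ℝ} (hm : ∀ k, Measurable (h k))
    (hi : ∀ k, Integrable (h k) ν) : Integrable (fun x => ⨆ k, h k x) ν := by
  refine (integrable_finsetSum Finset.univ fun k _ => (hi k).abs).mono'
    (Measurable.iSup hm).aestronglyMeasurable (ae_of_all _ fun x => ?_)
  obtain ⟨k, hk⟩ := exists_eq_ciSup_of_finite (f := fun k => h k x)
  rw [← hk, Real.norm_eq_abs]
  exact Finset.single_le_sum (f := fun k => |h k x|) (fun _ _ => abs_nonneg _) (Finset.mem_univ k)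

theorem IsMeasPartition.sum_setIntegral_le {ν : Measure X} {A : Set X} {B : κ → Set X}
    (hB : IsMeasPartition A B) {h : κ → X → ℝ} (hm : ∀ k, Measurable (h k))
    (hi : ∀ k, Integrable (h k) ν) :
    ∑ k, ∫ x in B k, h k x ∂ν ≤ ∫ x in A, ⨆ k, h k x ∂ν := by
  rw [← hB.sum_setIntegral (integrable_iSup hm hi)]
  exact Finset.sum_le_sum fun k _ => setIntegral_mono (hi k).integrableOn
    (integrable_iSup hm hi).integrableOn fun x => le_iSup_apply h k x

theorem IsMeasPartition.sum_setIntegral_eq {ν : Measure X} {A : Set X} {B : κ → Set X}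
    (hB : IsMeasPartition A B) {h : κ → X → ℝ} (hm : ∀ k, Measurable (h k))
    (hi : ∀ k, Integrable (h k) ν) (hmax : ∀ k l, ∀ x ∈ B k, h l x ≤ h k x) :
    ∑ k, ∫ x in B k, h k x ∂ν = ∫ x in A, ⨆ k, h k x ∂ν := by
  rw [← hB.sum_setIntegral (integrable_iSup hm hi)]
  refine Finset.sum_congr rfl fun k _ => setIntegral_congr_fun (hB.measurableSet k) fun x hx => ?_
  exact le_antisymm (le_iSup_apply h k x) (ciSup_le fun l => hmax k l x hx)

end Partition

/-! ### Value vectors of divisions and their support function -/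

section Densities

variable {X κ : Type*} [MeasurableSpace X]

/-- Values of the pieces of the division `B` under the measures with densities `F`. -/
noncomputable def divisionValue (ν : Measure X) (F : κ → X → ℝ) (B : κ → Set X) (j : κ) : ℝ :=
  ∫ x in B j, F j x ∂ν

/-- The largest `α`-weighted total value of a division under the measures with densities `F`. -/
noncomputable def maxWeightedValue (ν : Measure X) (F : κ → X → ℝ) (α : κ → ℝ) : ℝ :=
  ∫ x, ⨆ j, α j * F j x ∂ν

variable {ν : Measure X} {F : κ → X → ℝ}

theorem divisionValue_nonneg (hF0 : ∀ j x, 0 ≤ F j x) (B : κ → Set X) (j : κ) :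
    0 ≤ divisionValue ν F B j :=
  integral_nonneg (hF0 j)

variable [Fintype κ]

theorem divisionValue_le (hFi : ∀ j, Integrable (F j) ν) (hF0 : ∀ j x, 0 ≤ F j x)
    (B : κ → Set X) (j : κ) : divisionValue ν F B j ≤ ∑ k, ∫ x, F k x ∂ν :=
  (setIntegral_le_integral (hFi j) (ae_of_all _ (hF0 j))).trans
    (Finset.single_le_sum (f := fun k => ∫ x, F k x ∂ν) (fun k _ => integral_nonneg (hF0 k))
      (Finset.mem_univ j))

/-- If `F` vanishes at the atoms of `ν`, the closure of the set of value vectors of divisions is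
convex. -/
theorem convex_closure_range_divisionValue [StandardBorelSpace X] [IsFiniteMeasure ν]
    (hFm : ∀ j, Measurable (F j)) (hFi : ∀ j, Integrable (F j) ν)
    (hat : ∀ x, (∀ j, F j x = 0) ∨ ν {x} = 0) :
    Convex ℝ (closure {p | ∃ B, IsMeasPartition Set.univ B ∧ p = divisionValue ν F B}) := by
  set P := {p | ∃ B, IsMeasPartition Set.univ B ∧ p = divisionValue ν F B}
  have key : ∀ c : ℝ, 0 ≤ c → c ≤ 1 → ∀ p ∈ P, ∀ q ∈ P, c • p + (1 - c) • q ∈ closure P := by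
    rintro c hc₀ hc₁ _ ⟨B, hB, rfl⟩ _ ⟨B', hB', rfl⟩
    -- Using `B` on `E` and `B'` elsewhere changes the value vector of `B'` by `∫ x in E, φ x ∂ν`,
    -- so choosing `E` is a Lyapunov problem for `φ`.
    let φ : X → κ → ℝ := fun x j => (B j).indicator (F j) x - (B' j).indicator (F j) x
    have hφi : ∀ j, Integrable (fun x => φ x j) ν := fun j =>
      ((hFi j).indicator (hB.measurableSet j)).sub ((hFi j).indicator (hB'.measurableSet j))
    have hφm : Measurable φ := measurable_pi_iff.2 fun j =>
      ((hFm j).indicator (hB.measurableSet j)).sub ((hFm j).indicator (hB'.measurableSet j))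
    have hφint : ∀ E, MeasurableSet E → ∀ j, (∫ x in E, φ x ∂ν) j =
        ∫ x in E ∩ B j, F j x ∂ν - ∫ x in E ∩ B' j, F j x ∂ν := by
      intro E hE j
      rw [eval_integral fun j => (hφi j).integrableOn]
      rw [integral_sub ((hFi j).indicator (hB.measurableSet j)).integrableOn
        ((hFi j).indicator (hB'.measurableSet j)).integrableOn,
        setIntegral_indicator (hB.measurableSet j), setIntegral_indicator (hB'.measurableSet j)]
    -- `ν` may have atoms, but only where `F`, hence `φ`, vanishes; restricting to `Z` removes them
    -- and keeps the integrals of `φ`.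
    set Z : Set X := {x | φ x ≠ 0}
    have hZm : MeasurableSet Z := (hφm (measurableSet_singleton 0)).compl
    have hna : NullSingletonClass (ν.restrict Z) := by
      refine ⟨fun x => ?_⟩
      rcases hat x with hx | hx
      · rw [Measure.restrict_apply (measurableSet_singleton x)]
        have : {x} ∩ Z = ∅ := by
          refine Set.eq_empty_of_forall_notMem ?_
          rintro y ⟨rfl, hy⟩
          have h0 : ∀ (S : Set X) j, S.indicator (F j) y = 0 := fun S j =>
            Set.indicator_apply_eq_zero.2 fun _ => hx j
          exact hy (funext fun j => (congrArg₂ (· - ·) (h0 _ j) (h0 _ j)).trans (sub_self 0))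
        simp [this]
      · exact le_antisymm ((Measure.restrict_apply_le _ _).trans hx.le) zero_le
    rw [Metric.mem_closure_iff]
    intro ε hε
    obtain ⟨E, hE, hEε⟩ := exists_norm_setIntegral_sub_smul_integral_lt (ν.restrict Z)
      (Integrable.of_eval hφi).restrict hc₀ hc₁ hε
    have e1 : ∫ x in E, φ x ∂(ν.restrict Z) = ∫ x in E, φ x ∂ν := by
      rw [Measure.restrict_restrict hE]
      exact (setIntegral_eq_of_subset_of_forall_sdiff_eq_zero hE Set.inter_subset_left
        fun x hx => by_contra fun h => hx.2 ⟨hx.1, h⟩).symm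
    have e2 : ∫ x, φ x ∂(ν.restrict Z) = ∫ x, φ x ∂ν :=
      setIntegral_eq_integral_of_forall_compl_eq_zero fun x hx => by simpa [Z] using hx
    rw [e1, e2] at hEε
    refine ⟨divisionValue ν F fun j => E.ite (B j) (B' j), ⟨_, hB.ite hB' hE, rfl⟩, ?_⟩
    have e3 : divisionValue ν F (fun j => E.ite (B j) (B' j)) =
        divisionValue ν F B' + ∫ x in E, φ x ∂ν := by
      funext j
      rw [Pi.add_apply, hφint E hE]
      simp only [divisionValue, Set.ite]
      rw [setIntegral_union (Set.disjoint_left.2 fun x hx hy => hy.2 hx.2)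
        ((hB'.measurableSet j).diff hE) (hFi j).integrableOn (hFi j).integrableOn,
        ← integral_inter_add_sdiff hE (hFi j).integrableOn (s := B' j), Set.inter_comm E,
        Set.inter_comm E]
      ring
    have e4 : c • divisionValue ν F B + (1 - c) • divisionValue ν F B' =
        divisionValue ν F B' + c • ∫ x, φ x ∂ν := by
      funext j
      have := hφint Set.univ MeasurableSet.univ j
      simp only [Measure.restrict_univ, Set.univ_inter] at this
      simp only [Pi.add_apply, Pi.smul_apply, smul_eq_mul, this, divisionValue]
      ring
    rw [e3, e4, dist_comm, dist_eq_norm, add_sub_add_left_eq_sub]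
    exact hEε
  intro p hp q hq a b ha hb hab
  obtain rfl : b = 1 - a := by linarith
  rw [← closure_closure]
  exact map_mem_closure₂ (f := fun p q : κ → ℝ => a • p + (1 - a) • q) (by fun_prop) hp hq
    fun p hp q hq => key a ha (by linarith) p hp q hq

variable [Nonempty κ]

/-- Together with equality at an argmax division, this bound is the subgradient inequality for
`maxWeightedValue`. -/
theorem sum_mul_divisionValue_le (hFm : ∀ j, Measurable (F j)) (hFi : ∀ j, Integrable (F j) ν)
    {B : κ → Set X} (hB : IsMeasPartition Set.univ B) (α : κ → ℝ) :
    ∑ j, α j * divisionValue ν F B j ≤ maxWeightedValue ν F α := by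
  have := hB.sum_setIntegral_le (ν := ν) (h := fun j x => α j * F j x)
    (fun j => (hFm j).const_mul _) (fun j => (hFi j).const_mul _)
  simpa only [integral_const_mul, Measure.restrict_univ, divisionValue, maxWeightedValue] using this

theorem sum_mul_divisionValue_eq (hFm : ∀ j, Measurable (F j)) (hFi : ∀ j, Integrable (F j) ν)
    {B : κ → Set X} (hB : IsMeasPartition Set.univ B) {α : κ → ℝ}
    (hmax : ∀ k l, ∀ x ∈ B k, α l * F l x ≤ α k * F k x) :
    ∑ j, α j * divisionValue ν F B j = maxWeightedValue ν F α := by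
  have := hB.sum_setIntegral_eq (ν := ν) (h := fun j x => α j * F j x)
    (fun j => (hFm j).const_mul _) (fun j => (hFi j).const_mul _) hmax
  simpa only [integral_const_mul, Measure.restrict_univ, divisionValue, maxWeightedValue] using this

/-- A division optimal for `α` is still admissible for `β`, which yields a Lipschitz bound. -/
theorem continuous_maxWeightedValue (hFm : ∀ j, Measurable (F j))
    (hFi : ∀ j, Integrable (F j) ν) : Continuous (maxWeightedValue ν F) := by
  have key : ∀ α β : κ → ℝ, maxWeightedValue ν F α - maxWeightedValue ν F β ≤
      ∑ j, |α j - β j| * ∫ x, |F j x| ∂ν := by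
    intro α β
    obtain ⟨B, hB, hmax⟩ := exists_argmax_partition (h := fun j x => α j * F j x)
      fun j => (hFm j).const_mul _
    rw [← sum_mul_divisionValue_eq hFm hFi hB hmax]
    have h1 : ∑ j, (α j - β j) * divisionValue ν F B j ≤ ∑ j, |α j - β j| * ∫ x, |F j x| ∂ν := by
      refine Finset.sum_le_sum fun j _ => (le_abs_self _).trans ?_
      rw [abs_mul]
      refine mul_le_mul_of_nonneg_left ?_ (abs_nonneg _)
      exact abs_integral_le_integral_abs.trans
        (setIntegral_le_integral (hFi j).abs (ae_of_all _ fun x => abs_nonneg _))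
    simp only [sub_mul, Finset.sum_sub_distrib] at h1
    linarith [sum_mul_divisionValue_le hFm hFi hB β]
  refine continuous_iff_continuousAt.2 fun α => ?_
  rw [ContinuousAt, tendsto_iff_norm_sub_tendsto_zero]
  have hlim : Tendsto (fun β : κ → ℝ => ∑ j, |β j - α j| * ∫ x, |F j x| ∂ν) (𝓝 α) (𝓝 0) := by
    have : Continuous fun β : κ → ℝ => ∑ j, |β j - α j| * ∫ x, |F j x| ∂ν := by fun_prop
    simpa using this.tendsto α
  refine squeeze_zero (fun β => norm_nonneg _) (fun β => ?_) hlim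
  rw [Real.norm_eq_abs, abs_le']
  refine ⟨key β α, ?_⟩
  have := key α β
  simp only [abs_sub_comm (α _)] at this
  linarith

/-- Minimax: a value below every weighted optimum is exceeded simultaneously by all the pieces of
some division. -/
theorem exists_division_forall_lt [StandardBorelSpace X] [IsFiniteMeasure ν]
    (hFm : ∀ j, Measurable (F j)) (hFi : ∀ j, Integrable (F j) ν)
    (hat : ∀ x, (∀ j, F j x = 0) ∨ ν {x} = 0) {v : ℝ}
    (hv : ∀ β ∈ stdSimplex ℝ κ, v < maxWeightedValue ν F β) :
    ∃ B, IsMeasPartition Set.univ B ∧ ∀ j, v < divisionValue ν F B j := by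
  classical
  set P := {p | ∃ B, IsMeasPartition Set.univ B ∧ p = divisionValue ν F B}
  let Q : Set (κ → ℝ) := Set.univ.pi fun _ => Set.Ioi v
  have hQo : IsOpen Q := isOpen_set_pi Set.finite_univ fun _ _ => isOpen_Ioi
  have hQc : Convex ℝ Q := convex_pi fun _ _ => convex_Ioi v
  by_cases hdisj : Disjoint Q (closure P)
  · exfalso
    obtain ⟨y, c, hyQ, hyP⟩ := geometric_hahn_banach_open hQc hQo
      (convex_closure_range_divisionValue hFm hFi hat) hdisj
    let β : κ → ℝ := fun j => -y (Pi.single j 1)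
    have hy : ∀ u : κ → ℝ, y u = -∑ j, β j * u j := by
      intro u
      conv_lhs => rw [← Finset.univ_sum_single u]
      rw [map_sum, ← Finset.sum_neg_distrib]
      refine Finset.sum_congr rfl fun j _ => ?_
      have : (Pi.single j (u j) : κ → ℝ) = u j • Pi.single j 1 := by
        rw [← Pi.single_smul, smul_eq_mul, mul_one]
      rw [this, map_smul, smul_eq_mul]
      ring
    have hQ : ∀ u : κ → ℝ, (∀ j, v < u j) → -c < ∑ j, β j * u j := fun u hu => by
      have := hyQ u fun j _ => hu j
      rw [hy] at this
      linarith
    have hPc : ∀ p ∈ P, ∑ j, β j * p j ≤ -c := fun p hp => by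
      have := hyP p (subset_closure hp)
      rw [hy] at this
      linarith
    have hβ0 : ∀ j, 0 ≤ β j := by
      intro j
      by_contra! hj
      -- Raising coordinate `j` by `r` brings the functional exactly to `-c`, although the point
      -- stays in `Q` whenever `r ≥ 0`.
      set r := (∑ k, β k * (v + 1) + c) / (-β j) with hr
      have h1 := hQ (fun k => v + 1 + (Pi.single j (max r 0) : κ → ℝ) k) fun k => by
        have : 0 ≤ (Pi.single j (max r 0) : κ → ℝ) k := by
          by_cases hk : k = j
          · subst hk; simp
          · simp [hk]
        linarith
      simp only [mul_add, Finset.sum_add_distrib] at h1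
      have h2 : ∑ k, β k * (Pi.single j (max r 0) : κ → ℝ) k = β j * max r 0 := by
        simp [Pi.single_apply]
      rw [h2] at h1
      have h3 : β j * max r 0 ≤ β j * r := mul_le_mul_of_nonpos_left (le_max_left _ _) hj.le
      have h4 : β j * r = -(∑ k, β k * (v + 1) + c) := by
        rw [hr, mul_div_assoc', mul_comm (β j), mul_div_assoc, div_neg, div_self hj.ne, mul_neg_one]
      simp only [mul_add, Finset.sum_add_distrib] at h4
      linarith
    set σ := ∑ j, β j with hσ
    -- Approach the corner of the orthant along the diagonal.
    have hσv : -c ≤ σ * v := by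
      have hlim : Tendsto (fun η : ℝ => σ * (v + η)) (𝓝[>] 0) (𝓝 (σ * v)) := by
        have : Continuous fun η : ℝ => σ * (v + η) := by fun_prop
        simpa using (this.tendsto 0).mono_left nhdsWithin_le_nhds
      refine ge_of_tendsto hlim ?_
      filter_upwards [self_mem_nhdsWithin] with η hη
      have := hQ (fun _ => v + η) fun _ => by simpa using hη
      rw [← Finset.sum_mul] at this
      exact this.le
    have hσ0 : 0 < σ := by
      refine (Finset.sum_nonneg fun j _ => hβ0 j).lt_of_ne fun h => ?_
      have hβz : ∀ j, β j = 0 := fun j =>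
        (Finset.sum_eq_zero_iff_of_nonneg fun j _ => hβ0 j).1 h.symm j (Finset.mem_univ j)
      obtain ⟨B, hB, -⟩ := exists_argmax_partition (h := F) hFm
      have h1 := hPc _ ⟨B, hB, rfl⟩
      have h2 := hQ (fun _ => v + 1) fun _ => by linarith
      simp only [hβz, zero_mul, Finset.sum_const_zero] at h1 h2
      linarith
    -- For the normalised weights every division totals at most `-c / σ ≤ v`, against `hv`.
    have hmem : (fun j => β j / σ) ∈ stdSimplex ℝ κ :=
      ⟨fun j => div_nonneg (hβ0 j) hσ0.le, by rw [← Finset.sum_div, ← hσ, div_self hσ0.ne']⟩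
    obtain ⟨B, hB, hmax⟩ := exists_argmax_partition (h := fun j x => β j / σ * F j x)
      fun j => (hFm j).const_mul _
    have h1 := hv _ hmem
    rw [← sum_mul_divisionValue_eq hFm hFi hB hmax] at h1
    have h2 : ∑ j, β j / σ * divisionValue ν F B j = (∑ j, β j * divisionValue ν F B j) / σ := by
      rw [Finset.sum_div]
      exact Finset.sum_congr rfl fun j _ => by ring
    rw [h2, lt_div_iff₀ hσ0] at h1
    linarith [hPc _ ⟨B, hB, rfl⟩]
  · obtain ⟨q, hqQ, hqP⟩ := Set.not_disjoint_iff.1 hdisj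
    obtain ⟨_, hpQ, B, hB, rfl⟩ := mem_closure_iff.1 hqP Q hQo hqQ
    exact ⟨B, hB, fun j => hpQ j trivial⟩

/-- Near the boundary of the simplex, the pieces with small weight of an optimal division are worth
less than average. -/
theorem exists_forall_divisionValue_lt_avg (hFm : ∀ j, Measurable (F j))
    (hFi : ∀ j, Integrable (F j) ν) (hF0 : ∀ j x, 0 ≤ F j x) (hpos : ∀ j, 0 < ∫ x, F j x ∂ν)
    (hac : ∀ᵐ x ∂ν, ∀ j k, F j x = 0 → F k x = 0) :
    ∃ δ > 0, ∀ α ∈ stdSimplex ℝ κ, ∀ B, IsMeasPartition Set.univ B →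
      (∀ k l, ∀ x ∈ B k, α l * F l x ≤ α k * F k x) → ∀ j, α j ≤ δ →
        divisionValue ν F B j < avg (divisionValue ν F B) := by
  set m : ℝ := (Fintype.card κ : ℝ) with hm
  have hm0 : 0 < m := by simpa [hm] using Fintype.card_pos
  obtain ⟨h₀, hh₀⟩ := Finite.exists_min fun j => ∫ x, F j x ∂ν
  -- A lower bound for the average: some weight is at least `1 / m`, so the optimal weighted total,
  -- hence the plain total, is at least `(∫ x, F h₀ x ∂ν) / m`.
  set c₀ := (∫ x, F h₀ x ∂ν) / m / m with hc₀
  have hc₀pos : 0 < c₀ := div_pos (div_pos (hpos h₀) hm0) hm0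
  -- `N j k` contains piece `j` of every optimal division with `α j ≤ 1 / (k + 1)`: take `h` with `α
  -- h ≥ 1 / m`. This makes `δ` uniform in `α`.
  let N : κ → ℕ → Set X := fun j k => ⋃ h, {x | F h x ≤ m * (1 / (k + 1 : ℝ)) * F j x}
  have hNm : ∀ j k, MeasurableSet (N j k) := fun j k =>
    MeasurableSet.iUnion fun h => measurableSet_le (hFm h) ((hFm j).const_mul _)
  have hNanti : ∀ j, Antitone (N j) := by
    intro j k l hkl
    refine Set.iUnion_mono fun h x (hx : F h x ≤ _) => show F h x ≤ _ from hx.trans ?_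
    exact mul_le_mul_of_nonneg_right (mul_le_mul_of_nonneg_left
      (one_div_le_one_div_of_le (by positivity) (by simpa using hkl)) hm0.le) (hF0 j x)
  have hNlim : ∀ j, Tendsto (fun k => ∫ x in N j k, F j x ∂ν) atTop (𝓝 0) := by
    intro j
    have h1 := tendsto_setIntegral_of_antitone (hNm j) (hNanti j) ⟨0, (hFi j).integrableOn⟩
    -- Where `F j` is positive, almost surely so is every `F h`, and the point leaves `N j k` for
    -- large `k`.
    have h2 : ∫ x in ⋂ k, N j k, F j x ∂ν = 0 := by
      refine setIntegral_eq_zero_of_ae_eq_zero ?_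
      filter_upwards [hac] with x hx hxN
      by_contra hne
      have hpos' : ∀ h, 0 < F h x := fun h => (hF0 h x).lt_of_ne fun h0 => hne (hx h j h0.symm)
      obtain ⟨l, hl⟩ := Finite.exists_min fun h => F h x
      have hlim : Tendsto (fun k : ℕ => m * (1 / (k + 1 : ℝ)) * F j x) atTop
          (𝓝 (m * 0 * F j x)) :=
        (tendsto_one_div_add_atTop_nhds_zero_nat.const_mul m).mul_const _
      rw [mul_zero, zero_mul] at hlim
      obtain ⟨k, hk⟩ := (hlim.eventually (gt_mem_nhds (hpos' l))).exists
      obtain ⟨h, hh⟩ := Set.mem_iUnion.1 (Set.mem_iInter.1 hxN k)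
      exact absurd ((hl h).trans hh) (not_le.2 hk)
    rwa [h2] at h1
  obtain ⟨k, hk⟩ := (eventually_all.2 fun j =>
    (hNlim j).eventually (gt_mem_nhds hc₀pos)).exists
  refine ⟨1 / (k + 1 : ℝ), by positivity, fun α hα B hB hmax j hj => ?_⟩
  obtain ⟨h, hh⟩ : ∃ h, 1 / m ≤ α h := by
    by_contra! hlt
    have := Finset.sum_lt_sum_of_nonempty Finset.univ_nonempty fun h _ => hlt h
    rw [hα.2, Finset.sum_const, Finset.card_univ, nsmul_eq_mul, ← hm,
      mul_one_div_cancel hm0.ne'] at this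
    exact lt_irrefl _ this
  have hsub : B j ⊆ N j k := by
    intro x hx
    refine Set.mem_iUnion.2 ⟨h, ?_⟩
    have h1 := hmax j h x hx
    have h2 : 1 / m * F h x ≤ α h * F h x := mul_le_mul_of_nonneg_right hh (hF0 h x)
    have h3 : α j * F j x ≤ 1 / (k + 1 : ℝ) * F j x := mul_le_mul_of_nonneg_right hj (hF0 j x)
    have h4 := mul_le_mul_of_nonneg_left (h2.trans (h1.trans h3)) hm0.le
    rwa [← mul_assoc, mul_one_div_cancel hm0.ne', one_mul, ← mul_assoc] at h4
  have hlt : divisionValue ν F B j < c₀ :=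
    (setIntegral_mono_set (hFi j).integrableOn (ae_of_all _ (hF0 j))
      hsub.eventuallyLE).trans_lt (hk j)
  refine hlt.trans_le ?_
  rw [avg, ← hm, hc₀]
  refine div_le_div_of_nonneg_right ?_ hm0.le
  have h1 : α h * ∫ x, F h x ∂ν ≤ maxWeightedValue ν F α := by
    rw [← integral_const_mul]
    exact integral_mono ((hFi h).const_mul _)
      (integrable_iSup (h := fun j x => α j * F j x) (fun j => (hFm j).const_mul _)
        fun j => (hFi j).const_mul _) fun x => le_iSup_apply (fun j x => α j * F j x) h x
  rw [← sum_mul_divisionValue_eq hFm hFi hB hmax] at h1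
  have h2 : ∑ j, α j * divisionValue ν F B j ≤ ∑ j, divisionValue ν F B j :=
    Finset.sum_le_sum fun i _ => mul_le_of_le_one_left (divisionValue_nonneg hF0 B i)
      (hα.2 ▸ Finset.single_le_sum (fun l _ => hα.1 l) (Finset.mem_univ i))
  calc (∫ x, F h₀ x ∂ν) / m ≤ 1 / m * ∫ x, F h x ∂ν := by
        rw [one_div_mul_eq_div]; exact div_le_div_of_nonneg_right (hh₀ h) hm0.le
    _ ≤ α h * ∫ x, F h x ∂ν := mul_le_mul_of_nonneg_right hh (hpos h).le
    _ ≤ _ := h1.trans h2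

end Densities

/-! ### The subgradient method on the simplex and the minimax value -/

theorem avg_nonneg {κ : Type*} [Fintype κ] {u : κ → ℝ} (hu : ∀ j, 0 ≤ u j) : 0 ≤ avg u :=
  div_nonneg (Finset.sum_nonneg fun j _ => hu j) (Nat.cast_nonneg _)

section Method

variable {X κ : Type*} [MeasurableSpace X] [Fintype κ] [Nonempty κ] {ν : Measure X}
  {F : κ → X → ℝ}

theorem sum_sub_avg (u : κ → ℝ) : ∑ j, (u j - avg u) = 0 := by
  have : (Fintype.card κ : ℝ) ≠ 0 := Nat.cast_ne_zero.2 Fintype.card_ne_zero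
  rw [Finset.sum_sub_distrib, Finset.sum_const, Finset.card_univ, nsmul_eq_mul, avg,
    mul_div_cancel₀ _ this, sub_self]

theorem avg_le {u : κ → ℝ} {c : ℝ} (hu : ∀ j, u j ≤ c) : avg u ≤ c := by
  have h0 : (0 : ℝ) < Fintype.card κ := Nat.cast_pos.2 Fintype.card_pos
  rw [avg, div_le_iff₀ h0]
  calc ∑ j, u j ≤ ∑ _j : κ, c := Finset.sum_le_sum fun j _ => hu j
    _ = c * Fintype.card κ := by rw [Finset.sum_const, Finset.card_univ, nsmul_eq_mul, mul_comm]

/-- The subgradient method with suitable diminishing steps stays in the interior of the simplex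
after the first iterate and converges to a minimizer of `maxWeightedValue`. -/
theorem exists_steps_tendsto_minimizer (hFm : ∀ j, Measurable (F j))
    (hFi : ∀ j, Integrable (F j) ν) (hF0 : ∀ j x, 0 ≤ F j x) (hpos : ∀ j, 0 < ∫ x, F j x ∂ν)
    (hac : ∀ᵐ x ∂ν, ∀ j k, F j x = 0 → F k x = 0) {s : ℕ → ℝ} (hs : IsDiminishing s) :
    ∃ s' : ℕ → ℝ, IsDiminishing s' ∧ (∀ t, s' t ≤ s t) ∧
      ∀ α u : ℕ → κ → ℝ, α 0 ∈ stdSimplex ℝ κ →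
        (∀ t, ∃ B, IsMeasPartition Set.univ B ∧
          (∀ k l, ∀ x ∈ B k, α t l * F l x ≤ α t k * F k x) ∧ u t = divisionValue ν F B) →
        (∀ t j, α (t + 1) j = α t j - s' t * (u t j - avg (u t))) →
        (∀ t j, 0 < α t j - s' t * (u t j - avg (u t))) ∧
        (∀ t, α t ∈ stdSimplex ℝ κ) ∧
        ∃ a ∈ stdSimplex ℝ κ,
          (∀ b ∈ stdSimplex ℝ κ, maxWeightedValue ν F a ≤ maxWeightedValue ν F b) ∧
          Tendsto α atTop (𝓝 a) := by
  obtain ⟨δ, hδ, hbd⟩ := exists_forall_divisionValue_lt_avg hFm hFi hF0 hpos hac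
  set I := ∑ k, ∫ x, F k x ∂ν
  have hI0 : 0 < I := Finset.sum_pos (fun k _ => hpos k) Finset.univ_nonempty
  -- A weight above `δ` loses at most `s' t * I < δ` in one step; smaller weights increase, by
  -- `hbd`.
  obtain ⟨s', hs', hle, hsc, hsq⟩ :=
    hs.exists_le_summable_sq (c := δ / (I + 1)) (by positivity)
  refine ⟨s', hs', hle, fun α u hα0 hu hstep => ?_⟩
  choose B hB hmax huB using hu
  have hu0 : ∀ t j, 0 ≤ u t j := fun t j => huB t ▸ divisionValue_nonneg hF0 _ j
  have huI : ∀ t j, u t j ≤ I := fun t j => huB t ▸ divisionValue_le hFi hF0 _ j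
  have hposit : ∀ t, α t ∈ stdSimplex ℝ κ → ∀ j, 0 < α t j - s' t * (u t j - avg (u t)) := by
    intro t ht j
    have h0 := ht.1 j
    have hst := hs'.pos t
    rcases le_or_gt (α t j) δ with h | h
    · have := hbd _ ht _ (hB t) (hmax t) j h
      rw [← huB t] at this
      nlinarith
    · have h1 : u t j - avg (u t) ≤ I := by linarith [huI t j, avg_nonneg (hu0 t)]
      have h2 : s' t * (u t j - avg (u t)) ≤ s' t * I := mul_le_mul_of_nonneg_left h1 hst.le
      have h3 : s' t * (I + 1) ≤ δ := (le_div_iff₀ (by positivity)).1 (hsc t)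
      linarith
  have hα : ∀ t, α t ∈ stdSimplex ℝ κ := by
    intro t
    induction t with
    | zero => exact hα0
    | succ t ih =>
      refine ⟨fun j => ?_, ?_⟩
      · rw [hstep]; exact (hposit t ih j).le
      · simp only [hstep]
        rw [Finset.sum_sub_distrib, ← Finset.mul_sum, sum_sub_avg, mul_zero, sub_zero, ih.2]
  refine ⟨fun t => hposit t (hα t), hα, ?_⟩
  refine exists_tendsto_of_subgradient_step (isCompact_stdSimplex ℝ κ)
    (continuous_maxWeightedValue hFm hFi) (p := fun t j => u t j - avg (u t)) hs' hsq hα hstep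
    (M := ∑ _j : κ, I ^ 2) (fun t => ?_) (fun t b hb => ?_)
  · refine Finset.sum_le_sum fun j _ => sq_le_sq' ?_ ?_
    · linarith [hu0 t j, avg_le (huI t)]
    · linarith [huI t j, avg_nonneg (hu0 t)]
  · have h1 := sum_mul_divisionValue_le hFm hFi (hB t) b
    have h2 := sum_mul_divisionValue_eq hFm hFi (hB t) (hmax t)
    rw [← huB t] at h1 h2
    -- The average drops out because `b` and `α t` have the same coordinate sum.
    have h3 : ∑ j, (u t j - avg (u t)) * (b j - α t j) =
        ∑ j, b j * u t j - ∑ j, α t j * u t j - avg (u t) * (∑ j, b j - ∑ j, α t j) := by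
      rw [← Finset.sum_sub_distrib, ← Finset.sum_sub_distrib, Finset.mul_sum,
        ← Finset.sum_sub_distrib]
      exact Finset.sum_congr rfl fun j _ => by ring
    rw [h3, hb.2, (hα t).2, sub_self, mul_zero, sub_zero]
    linarith

/-- The minimum of `maxWeightedValue` over the simplex is the maxmin value of the division
problem. -/
theorem maxWeightedValue_eq_sSup [StandardBorelSpace X] [IsFiniteMeasure ν]
    (hFm : ∀ j, Measurable (F j)) (hFi : ∀ j, Integrable (F j) ν)
    (hat : ∀ x, (∀ j, F j x = 0) ∨ ν {x} = 0) {a : κ → ℝ} (ha : a ∈ stdSimplex ℝ κ)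
    (hmin : ∀ b ∈ stdSimplex ℝ κ, maxWeightedValue ν F a ≤ maxWeightedValue ν F b) :
    maxWeightedValue ν F a =
      sSup {r | ∃ B, IsMeasPartition Set.univ B ∧ r = ⨅ j, divisionValue ν F B j} := by
  have hub : ∀ r ∈ {r | ∃ B, IsMeasPartition Set.univ B ∧ r = ⨅ j, divisionValue ν F B j},
      r ≤ maxWeightedValue ν F a := by
    rintro _ ⟨B, hB, rfl⟩
    refine le_trans ?_ (sum_mul_divisionValue_le hFm hFi hB a)
    calc ⨅ j, divisionValue ν F B j = ∑ k, a k * ⨅ j, divisionValue ν F B j := by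
          rw [← Finset.sum_mul, ha.2, one_mul]
      _ ≤ _ := Finset.sum_le_sum fun k _ => mul_le_mul_of_nonneg_left
          (ciInf_le (Set.finite_range _).bddBelow k) (ha.1 k)
  refine le_antisymm (le_of_forall_lt fun v hv => ?_) (csSup_le ?_ hub)
  · obtain ⟨B, hB, hvB⟩ := exists_division_forall_lt hFm hFi hat
      fun b hb => hv.trans_le (hmin b hb)
    obtain ⟨j, hj⟩ := exists_eq_ciInf_of_finite (f := divisionValue ν F B)
    exact (hj ▸ hvB j).trans_le (le_csSup ⟨_, hub⟩ ⟨B, hB, rfl⟩)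
  · obtain ⟨B, hB, -⟩ := exists_argmax_partition (h := F) hFm
    exact ⟨_, B, hB, rfl⟩

end Method

/-! ### Coalition densities and the role of (CD) and (MAC) -/

theorem coalitionDensity_nonneg {X ι : Type*} {f : ι → X → ℝ} (hf : ∀ i x, 0 ≤ f i x) (S : Finset ι) (x : X) :
    0 ≤ coalitionDensity f S x :=
  Real.iSup_nonneg fun i : S => hf i x

theorem le_coalitionDensity {X ι : Type*} (f : ι → X → ℝ) {S : Finset ι} {i : ι} (hi : i ∈ S) (x : X) :
    f i x ≤ coalitionDensity f S x :=
  le_iSup_apply (fun i : S => f i) ⟨i, hi⟩ x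

section Coalitions

variable {X : Type*} [MeasurableSpace X]

theorem IsRNDensity.integrable {μ ν : Measure X} [IsFiniteMeasure μ] {f : X → ℝ}
    (hf : IsRNDensity μ ν f) : Integrable f ν := by
  refine ⟨hf.measurable.aestronglyMeasurable, ?_⟩
  rw [hasFiniteIntegral_iff_ofReal (ae_of_all _ hf.nonneg)]
  have := hf.apply_eq Set.univ MeasurableSet.univ
  rw [Measure.restrict_univ] at this
  exact this ▸ measure_lt_top μ _

theorem IsRNDensity.measureReal_eq {μ ν : Measure X} {f : X → ℝ} (hf : IsRNDensity μ ν f)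
    {A : Set X} (hA : MeasurableSet A) : μ.real A = ∫ x in A, f x ∂ν := by
  rw [measureReal_def, hf.apply_eq A hA, integral_eq_lintegral_of_nonneg_ae
    (ae_of_all _ hf.nonneg) hf.measurable.aestronglyMeasurable]

variable {ι : Type*} {μ : ι → Measure X} {ν : Measure X} {f : ι → X → ℝ}

theorem measurable_coalitionDensity (hf : ∀ i, Measurable (f i)) (S : Finset ι) :
    Measurable (coalitionDensity f S) :=
  Measurable.iSup fun i : S => hf i

theorem integrable_coalitionDensity (hf : ∀ i, Measurable (f i)) (hi : ∀ i, Integrable (f i) ν)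
    {S : Finset ι} (hS : S.Nonempty) : Integrable (coalitionDensity f S) ν :=
  have := hS.to_subtype
  integrable_iSup (fun i : S => hf i) fun i : S => hi i

/-- The joint preference of a coalition has the maximum of the densities as density. -/
theorem coalitionValue_eq_setIntegral (hf : ∀ i, IsRNDensity (μ i) ν (f i))
    (hi : ∀ i, Integrable (f i) ν) {S : Finset ι} (hS : S.Nonempty) {B : Set X}
    (hB : MeasurableSet B) : coalitionValue μ S B = ∫ x in B, coalitionDensity f S x ∂ν := by
  have := hS.to_subtype
  have hm : ∀ i : S, Measurable (f i) := fun i => (hf i).measurable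
  have hval : ∀ D : S → Set X, IsMeasPartition B D →
      ∑ i : S, (μ i).real (D i) = ∑ i : S, ∫ x in D i, f i x ∂ν := fun D hD =>
    Finset.sum_congr rfl fun i _ => (hf i).measureReal_eq (hD.measurableSet i)
  refine IsGreatest.csSup_eq ⟨?_, ?_⟩
  · obtain ⟨D, hD, hmax⟩ := exists_argmax_partition (h := fun i : S => f i) hm
    have hD' := hD.inter_right hB
    rw [Set.univ_inter] at hD'
    refine ⟨_, hD', ?_⟩
    rw [hval _ hD']
    exact (hD'.sum_setIntegral_eq hm (fun i => hi i) fun k l x hx => hmax k l x hx.1).symm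
  · rintro _ ⟨D, hD, rfl⟩
    rw [hval _ hD]
    exact hD.sum_setIntegral_le hm fun i => hi i

/-- Under mutual absolute continuity, the densities have almost everywhere the same zeros. -/
theorem MutuallyAbsCont.ae_density_eq_zero [Finite ι] (hMAC : MutuallyAbsCont μ)
    (hf : ∀ i, IsRNDensity (μ i) ν (f i)) : ∀ᵐ x ∂ν, ∀ i k, f i x = 0 → f k x = 0 := by
  refine ae_all_iff.2 fun i => ae_all_iff.2 fun k => ?_
  have hA : MeasurableSet {x | f i x = 0} := (hf i).measurable (measurableSet_singleton 0)
  have hiA : μ i {x | f i x = 0} = 0 := by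
    rw [(hf i).apply_eq _ hA, setLIntegral_congr_fun (g := fun _ => 0) hA fun x hx => by
      rw [Set.mem_ofPred_eq] at hx; simp [hx]]
    simp
  have hkA : μ k {x | f i x = 0} = 0 := by
    rcases eq_or_ne i k with rfl | hne
    · exact hiA
    · by_contra h
      exact (hMAC k _ hA (pos_iff_ne_zero.2 h) i hne).ne' hiA
  rw [(hf k).apply_eq _ hA, lintegral_eq_zero_iff (hf k).measurable.ennreal_ofReal,
    EventuallyEq, ae_restrict_iff' hA] at hkA
  filter_upwards [hkA] with x hx hx0
  exact le_antisymm (ENNReal.ofReal_eq_zero.1 (hx hx0)) ((hf k).nonneg x)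

/-- A singleton cannot be split into two parts of positive measure, so each `μ i` gives it mass
zero, and this mass is `f i x` times `ν {x}`. -/
theorem CompletelyDivisible.density_eq_zero_or [MeasurableSingletonClass X]
    (hCD : CompletelyDivisible μ) (hf : ∀ i, IsRNDensity (μ i) ν (f i)) (x : X) :
    (∀ i, f i x = 0) ∨ ν {x} = 0 := by
  refine or_iff_not_imp_right.2 fun hx i => ?_
  have h0 : μ i {x} = 0 := by
    by_contra h
    obtain ⟨B, -, hB, h1, h2⟩ := hCD i {x} (measurableSet_singleton x) (pos_iff_ne_zero.2 h)
    rcases Set.subset_singleton_iff_eq.1 hB with rfl | rfl <;> simp at h1 h2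
  rw [(hf i).apply_eq _ (measurableSet_singleton x), lintegral_singleton, mul_eq_zero] at h0
  exact le_antisymm (ENNReal.ofReal_eq_zero.1 (h0.resolve_right hx)) ((hf i).nonneg x)

end Coalitions

end FairDivision

/-! ### The main theorem -/

theorem mainTheorem3 {d n : ℕ} (C : Set (EuclideanSpace ℝ (Fin d))) (hC : MeasurableSet C)
    (μ : Fin n → Measure C) (hμ : ∀ i, IsProbabilityMeasure (μ i))
    (ν : Measure C) (hν : IsFiniteMeasure ν)
    (f : Fin n → C → ℝ) (hf : ∀ i, FairDivision.IsRNDensity (μ i) ν (f i))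
    (Γ : Finpartition (Finset.univ : Finset (Fin n)))
    (w : Finset (Fin n) → ℝ) (hw : ∀ S ∈ Γ.parts, 0 < w S)
    (hCD : FairDivision.CompletelyDivisible μ) (hMAC : FairDivision.MutuallyAbsCont μ)
    (s : ℕ → ℝ) (hs : FairDivision.IsDiminishing s) :
    ∃ s' : ℕ → ℝ, FairDivision.IsDiminishing s' ∧ (∀ t, s' t ≤ s t) ∧
      ∀ α u : ℕ → Γ.parts → ℝ, α 0 ∈ stdSimplex ℝ Γ.parts →
        (∀ t, FairDivision.IsPVV μ f w Γ (α t) (u t)) →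
        (∀ t j, α (t + 1) j = α t j - s' t * (u t j - FairDivision.avg (u t))) →
        (∀ t j, 0 < α t j - s' t * (u t j - FairDivision.avg (u t))) ∧
        (∀ t, α t ∈ stdSimplex ℝ Γ.parts) ∧
        ((∃ t, α t ∈ FairDivision.minimizers ν f w Γ) ∨
          ∃ a ∈ FairDivision.minimizers ν f w Γ,
            Tendsto α atTop (𝓝 a) ∧
            Tendsto (fun t => FairDivision.g ν f w Γ (α t)) atTop
              (𝓝 (FairDivision.g ν f w Γ a)) ∧
            FairDivision.g ν f w Γ a = FairDivision.maxminValue μ w Γ) := by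
  open FairDivision in
  rcases isEmpty_or_nonempty Γ.parts with hemp | hne
  -- Without coalitions the simplex is empty.
  · refine ⟨s, hs, fun _ => le_rfl, fun α u hα0 => ?_⟩
    simpa using hα0.2
  have : StandardBorelSpace C := hC.standardBorel
  let F : Γ.parts → C → ℝ := weightedDensity f w Γ
  have hfm := fun i => (hf i).measurable
  have hfi := fun i => (hf i).integrable
  have hS : ∀ j : Γ.parts, (j : Finset (Fin n)).Nonempty := fun j =>
    Γ.nonempty_of_mem_parts j.2
  have hw' : ∀ j : Γ.parts, 0 < w j := fun j => hw j j.2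
  have hFm : ∀ j, Measurable (F j) := fun j => (measurable_coalitionDensity hfm j).div_const _
  have hFi : ∀ j, Integrable (F j) ν := fun j =>
    (integrable_coalitionDensity hfm hfi (hS j)).div_const _
  have hF0 : ∀ j x, 0 ≤ F j x := fun j x =>
    div_nonneg (coalitionDensity_nonneg (fun i => (hf i).nonneg) j x) (hw' j).le
  have hpos : ∀ j, 0 < ∫ x, F j x ∂ν := by
    intro j
    obtain ⟨i, hi⟩ := hS j
    have h1 : ∫ x, F j x ∂ν = (∫ x, coalitionDensity f j x ∂ν) / w j := integral_div _ _
    have h2 : (1 : ℝ) ≤ ∫ x, coalitionDensity f j x ∂ν := by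
      have h3 := (hf i).measureReal_eq MeasurableSet.univ
      rw [Measure.restrict_univ, probReal_univ] at h3
      rw [h3]
      exact integral_mono (hfi i) (integrable_coalitionDensity hfm hfi (hS j))
        (le_coalitionDensity f hi)
    rw [h1]
    exact div_pos (one_pos.trans_le h2) (hw' j)
  have hF_zero : ∀ x, (∀ i, f i x = 0) → ∀ j, F j x = 0 := by
    intro x hx j
    have := (hS j).to_subtype
    simp [F, weightedDensity, coalitionDensity, hx]
  have hac : ∀ᵐ x ∂ν, ∀ j k, F j x = 0 → F k x = 0 := by
    filter_upwards [hMAC.ae_density_eq_zero hf] with x hx j k hj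
    obtain ⟨i, hi⟩ := hS j
    have h1 : coalitionDensity f j x = 0 := (div_eq_zero_iff.1 hj).resolve_right (hw' j).ne'
    have h2 : f i x = 0 := le_antisymm (h1 ▸ le_coalitionDensity f hi x) ((hf i).nonneg x)
    exact hF_zero x (fun l => hx i l h2) k
  have hat : ∀ x, (∀ j, F j x = 0) ∨ ν {x} = 0 := fun x =>
    (hCD.density_eq_zero_or hf x).imp_left (hF_zero x)
  have hval : ∀ B : Γ.parts → Set C, IsMeasPartition Set.univ B →
      (fun j => weightedValue μ w Γ j (B j)) = divisionValue ν F B := by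
    intro B hB
    funext j
    rw [weightedValue, coalitionValue_eq_setIntegral hf hfi (hS j) (hB.measurableSet j)]
    exact (integral_div _ _).symm
  obtain ⟨s', hs', hle, hconv⟩ := exists_steps_tendsto_minimizer hFm hFi hF0 hpos hac hs
  refine ⟨s', hs', hle, fun α u hα0 hu hstep => ?_⟩
  obtain ⟨hp, hα, a, ha, hmin, hlim⟩ := hconv α u hα0 (fun t => by
    obtain ⟨B, hB, hmax, huB⟩ := hu t
    exact ⟨B, hB, fun k l x hx => hmax k l x hx, (funext huB).trans (hval B hB)⟩) hstep
  -- The second alternative holds in every case.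
  refine ⟨hp, hα, Or.inr ⟨a, ⟨ha, hmin⟩, hlim, ?_, ?_⟩⟩
  · exact ((continuous_maxWeightedValue hFm hFi).tendsto a).comp hlim
  · refine (maxWeightedValue_eq_sSup hFm hFi hat ha hmin).trans ?_
    rw [maxminValue]
    congr 1
    ext r
    refine exists_congr fun B => and_congr_right fun hB => ?_
    rw [← hval B hB]
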